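/- Let $m\ge 1$, let $A^E\in\mathbb R^{p\times m}$, $A^I\in\mathbb R^{q\times m}$, $b^E\in\mathbb R^p$, $b^I\in\mathbb R^q$, and let $$\mathcal C=\{x\in\mathbb R^m : A^Ex=b^E,\ A^Ix\le b^I,\ x\ge 0\},\qquad G(x)=-\sum_i x_i\ln x_i+\Bigl(\sum_i x_i\Bigr)\ln\Bigl(\sum_i x_i\Bigr)\quad(x\ge 0,\ 0\ln 0=0).$$ Assume that $\mathcal C$ is non-empty and that the sums $\sum_i x_i$, $x\in\mathcal C$, are bounded. Let $s_1=\min_{x\in\mathcal C}\sum_i x_i$, $s_2=\max_{x\in\mathcal C}\sum_i x_i$, let $x^*$ maximize $G$ over $\mathcal C$, and put $G^*=G(x^*)$, $s^*=\sum_i x_i^*$, $\chi^*=x^*/s^*$, $n^*=\lceil s^*\rceil$, $n_1=\lceil s_1\rceil$, $n_2=\lceil s_2\rceil$. Assume $x_i^*>1$ for every $i$. A *count vector* is a $\nu\in\mathbb N^m$; the number $\#\nu$ of its realizations is the number of finite sequences over $\{1,\dots,m\}$ in which each $i$ occurs exactly $\nu_i$ times (a multinomial coefficient), and for a set $S$ of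 count vectors $\#S=\sum_{\nu\in S}\#\nu$. An *optimal count vector* $\nu^*$ is obtained as follows: round each entry of $n^*\chi^*$ to a nearest integer, giving $\tilde\nu$, and let $d=\sum_i\tilde\nu_i-n^*$; if $d=0$ take $\nu^*=\tilde\nu$; if $d<0$ add $1$ to $|d|$ of the entries that were rounded down; if $d>0$ subtract $1$ from $|d|$ of the entries that were rounded up. Let $\beta^E,\beta^I$ be identical to $b^E,b^I$ except that zero entries are replaced by positive constants. For $\delta,\eta>0$ let $$\mathcal C(\delta)=\{x\in\mathbb R^m : b^E-\delta|\beta^E|\le A^Ex\le b^E+\delta|\beta^E|,\ A^Ix\le b^I+\delta|\beta^I|\},$$ $$\mathcal B_{n_1:n_2}(\delta,\eta)=\Bigl\{\nu\in\mathbb N^m : n_1\le\sum_i\nu_i\le n_2,\ \nu\in\mathcal C(\delta),\ G(\nu)<(1-\eta)G^*\Bigr\}.$$ Then for every $\delta,\eta>0$ and every optimal count vector $\nu^*$, $$\frac{\#\nu^*}{\#\mathcal B_{n_1:n_2}(\delta,\eta)}\;>\;\frac{(m+1)\,e^{-m/12}\,\Gamma(m/2)}{2\pi^{m/2}}\;\frac{C_2(x^*)\,C_4(x^*)}{C_3(s_1,s_2)}\;e^{\eta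 G^*},$$ where $$C_2(x^*)=\sqrt{s^*}\prod_{i=1}^m\frac{\chi_i^*}{\sqrt{x_i^*+1}},\qquad C_4(x^*)=\exp\Bigl(-\tfrac12\Bigl(\sum_{i=1}^m\frac1{x_i^*-1}-\frac{m}{s^*/m-1}\Bigr)\Bigr),$$ $$C_3(s_1,s_2)=\bigl(\sqrt m+\sqrt{s_2+2}\bigr)^{m+1}-\bigl(\sqrt m+\sqrt{s_1}\bigr)^{m+1}.$$ If $\mathcal B_{n_1:n_2}(\delta,\eta)$ is empty, the ratio is read as $+\infty$; that is, the inequality is understood after multiplying both sides by $\#\mathcal B_{n_1:n_2}(\delta,\eta)$. -/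

import Mathlib

open scoped BigOperators

noncomputable section

namespace MaxGEnt

/-- Data of a linear constraint system on vectors in `ℝ^m`: `p` equalities `AE x = bE`
and `q` inequalities `AI x ≤ bI`. No assumption is made on the entries. -/
structure ConstraintData (m p q : ℕ) where
  AE : Matrix (Fin p) (Fin m) ℝ
  bE : Fin p → ℝ
  AI : Matrix (Fin q) (Fin m) ℝ
  bI : Fin q → ℝ

variable {m p q : ℕ}

/-- The generalized entropy `G(x) = - ∑ xᵢ ln xᵢ + (∑ xᵢ) ln (∑ xᵢ)`, used for `x ≥ 0`
(with `0 ln 0 = 0`, which is what `Real.log 0 = 0` gives). -/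
def genEntropy (x : Fin m → ℝ) : ℝ :=
  -(∑ i, x i * Real.log (x i)) + (∑ i, x i) * Real.log (∑ i, x i)

/-- The polytope `{x ∈ ℝ^m | AE x = bE, AI x ≤ bI, x ≥ 0}`. -/
def ConstraintData.feasible (D : ConstraintData m p q) : Set (Fin m → ℝ) :=
  {x | D.AE.mulVec x = D.bE ∧ D.AI.mulVec x ≤ D.bI ∧ 0 ≤ x}

/-- `x` maximizes the generalized entropy over the feasible polytope. -/
def ConstraintData.IsMaxGEnt (D : ConstraintData m p q) (x : Fin m → ℝ) : Prop :=
  x ∈ D.feasible ∧ ∀ y ∈ D.feasible, genEntropy y ≤ genEntropy x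

/-- The set of sums `x₁ + ⋯ + x_m` of the feasible vectors. -/
def ConstraintData.sums (D : ConstraintData m p q) : Set ℝ :=
  (fun x : Fin m → ℝ => ∑ i, x i) '' D.feasible

/-- `β` is identical to `b`, except that the zero elements of `b` are replaced by
positive constants. -/
def IsToleranceVector {k : ℕ} (b β : Fin k → ℝ) : Prop :=
  ∀ i, (b i ≠ 0 → β i = b i) ∧ (b i = 0 → 0 < β i)

/-- The vectors that satisfy the constraints up to relative tolerance `δ`, that is
`bE - δ|βE| ≤ AE x ≤ bE + δ|βE|` and `AI x ≤ bI + δ|βI|`. -/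
def ConstraintData.tolerant (D : ConstraintData m p q) (βE : Fin p → ℝ) (βI : Fin q → ℝ)
    (δ : ℝ) : Set (Fin m → ℝ) :=
  {x | (∀ i, D.bE i - δ * |βE i| ≤ D.AE.mulVec x i) ∧
       (∀ i, D.AE.mulVec x i ≤ D.bE i + δ * |βE i|) ∧
       (∀ i, D.AI.mulVec x i ≤ D.bI i + δ * |βI i|)}

/-- The count vector of a finite sequence (assignment of balls to `m` bins). -/
def countVector (σ : List (Fin m)) : Fin m → ℕ := fun i => σ.count i

/-- `#S`: the number of realizations of a set `S` of count vectors, i.e. the number of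
finite sequences over `{1, …, m}` whose count vector belongs to `S`. -/
def numRealizations (S : Set (Fin m → ℕ)) : ℕ :=
  {σ : List (Fin m) | countVector σ ∈ S}.ncard

/-- The count vectors `ν` with `n₁ ≤ ∑ νᵢ ≤ n₂` that satisfy the constraints up to
tolerance `δ` and have `G(ν) < (1 - η) Gstar`. -/
def ConstraintData.lowEntropySet (D : ConstraintData m p q) (βE : Fin p → ℝ)
    (βI : Fin q → ℝ) (n₁ n₂ : ℕ) (Gstar δ η : ℝ) : Set (Fin m → ℕ) :=
  {ν | n₁ ≤ ∑ i, ν i ∧ ∑ i, ν i ≤ n₂ ∧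
       (fun i => (ν i : ℝ)) ∈ D.tolerant βE βI δ ∧
       genEntropy (fun i => (ν i : ℝ)) < (1 - η) * Gstar}

/-- `ν` is an optimal count vector constructed from `x`. With `s = ∑ xᵢ`, `n = ⌈s⌉` and
`χ = x / s`, round each entry of `n χ` to a nearest integer, giving `ρ`, and let
`d = ∑ ρᵢ - n`. If `d = 0` then `ν = ρ`; if `d < 0`, add 1 to `|d|` entries of `ρ` that were
rounded down; if `d > 0`, subtract 1 from `|d|` entries that were rounded up.
The result depends on the choice of these entries (and of the direction in which
half-integers are rounded); the predicate admits every choice. -/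
def IsOptimalCountVector (x : Fin m → ℝ) (ν : Fin m → ℕ) : Prop :=
  ∃ (ρ : Fin m → ℤ) (T : Finset (Fin m)),
    (∀ i, |(ρ i : ℝ) - (⌈∑ j, x j⌉₊ : ℝ) * (x i / ∑ j, x j)| ≤ 1 / 2) ∧
    (T.card : ℤ) = |∑ i, ρ i - (⌈∑ j, x j⌉₊ : ℤ)| ∧
    (∑ i, ρ i - (⌈∑ j, x j⌉₊ : ℤ) = 0 → ∀ i, (ν i : ℤ) = ρ i) ∧
    (∑ i, ρ i - (⌈∑ j, x j⌉₊ : ℤ) < 0 →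
      (∀ i ∈ T, (ρ i : ℝ) < (⌈∑ j, x j⌉₊ : ℝ) * (x i / ∑ j, x j)) ∧
      (∀ i, (ν i : ℤ) = if i ∈ T then ρ i + 1 else ρ i)) ∧
    (0 < ∑ i, ρ i - (⌈∑ j, x j⌉₊ : ℤ) →
      (∀ i ∈ T, (⌈∑ j, x j⌉₊ : ℝ) * (x i / ∑ j, x j) < (ρ i : ℝ)) ∧
      (∀ i, (ν i : ℤ) = if i ∈ T then ρ i - 1 else ρ i))

/-- `C₂(x) = √s ∏ χᵢ / √(xᵢ + 1)`, where `s = ∑ xᵢ` and `χ = x / s`. -/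
def C2 (x : Fin m → ℝ) : ℝ :=
  Real.sqrt (∑ j, x j) * ∏ i, (x i / ∑ j, x j) / Real.sqrt (x i + 1)

/-- `C₃(s₁, s₂) = (√m + √(s₂ + 2))^(m+1) - (√m + √s₁)^(m+1)`. -/
def C3 (m : ℕ) (s₁ s₂ : ℝ) : ℝ :=
  (Real.sqrt m + Real.sqrt (s₂ + 2)) ^ (m + 1) - (Real.sqrt m + Real.sqrt s₁) ^ (m + 1)

/-- `C₄(x) = exp (-½ (∑ 1/(xᵢ - 1) - m/(s/m - 1)))`, where `s = ∑ xᵢ`. -/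
def C4 (x : Fin m → ℝ) : ℝ :=
  Real.exp (-(1 / 2) * ((∑ i, 1 / (x i - 1)) - (m : ℝ) / ((∑ j, x j) / m - 1)))

/-- The sequences counted by `numRealizations` form a finite set whenever the sums of the
count vectors in `S` are bounded, so the count is a genuine cardinality. -/
theorem finite_realizations {S : Set (Fin m → ℕ)} {n : ℕ} (hS : ∀ ν ∈ S, ∑ i, ν i ≤ n) :
    {σ : List (Fin m) | countVector σ ∈ S}.Finite := by
  refine (List.finite_length_le (Fin m) n).subset fun σ hσ => ?_
  have h := hS _ hσ
  have h2 : ∑ i, countVector σ i = σ.length := by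
    have := Multiset.sum_count_eq_card (s := Finset.univ) (m := (σ : Multiset (Fin m)))
      (fun a _ => Finset.mem_univ a)
    simpa [countVector] using this
  simpa [h2] using h

end MaxGEnt

end

/-!
The ratio is bounded by estimating both counts against `exp G`, where `G` is the generalized entropy.

*The low-entropy set.* By Stirling's formula a count vector `ν` with sum `n` has at most
`exp (G ν) · √(2πn) ∏ 1 / √(2πνᵢ)` realizations, the product running over the positive entries. The
sum of these weights over all `ν` with sum `n` is `√(2πn)` times the coefficient of `X^n` in
`(1 + ∑_{j ≥ 1} X^j / √(2πj))^m`. The inner series is dominated coefficientwise by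
`X (1 - X)^(-1/2) / √2`, because the coefficients of `(1 - X)^(-1/2)` are quotients of Gamma values,
and Gamma is log-convex. The `k`-th power of the dominating series is explicit, which bounds the
weights of the vectors with `k` positive entries (`coeff_stirlingSeries_pow_le`). Log-convexity also
replaces `Γ(k/2)` by `Γ(m/2)` at the cost of a power of `√m`, so that the binomial theorem gives a
multiple of `((√m + √n)^m - √m^m) / √n` (`sqrt_mul_coeff_le_levelBound`). This is at most the
increment from `n` to `n + 1` of a multiple of `(√m + √n)^(m+1)` (`levelBound_le_sub`), and summing
over `n` telescopes to less than `C₃`. As `G ν < (1 - η) G*` on the set, the factor `exp (η G*)`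
results.

*The optimal vector.* The entries of `ν*` are positive, so Stirling's formula bounds its number of
realizations from below, the factors `j! / (√(2πj) (j/e)^j)` being at most `e / √(2π) < e^(1/12)`
(`le_numRealizations_singleton`). Since `n* ≥ s*`, the entries of `ν*` exceed `xᵢ* - 1`. The
generalized entropy is monotone and superadditive (`genEntropy_add_le`), so it suffices to compare
`G(x* - 1)` with `G(x*)`, and this difference is at least `∑ ln χᵢ* + ln C₄`, by Jensen's inequality
for a one-variable convex function (`genEntropy_le_genEntropy_sub_one`). Finally `1 / √νᵢ*` has to be
compared with `1 / √(xᵢ* + 1)`. An entry of `ν*` may exceed `xᵢ* + 1`, as `s*` is rounded up to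
`n*`; the loss from such entries is covered by the factor `√(n*/s*)` and by the entropy they add
(`genEntropy_sub_sum_log_le`).
-/

namespace MaxGEnt

/-! ### Half-integer steps of the Gamma function -/

/-- Log-convexity of Gamma between `x` and `x + 1`. -/
theorem Gamma_add_half_le {x : ℝ} (hx : 0 < x) :
    Real.Gamma (x + 1 / 2) ≤ Real.Gamma x * Real.sqrt x := by
  have h := Real.Gamma_mul_add_mul_le_rpow_Gamma_mul_rpow_Gamma (s := x) (t := x + 1)
    (a := 1 / 2) (b := 1 / 2) hx (by linarith) (by norm_num) (by norm_num) (by norm_num)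
  rw [← Real.sqrt_eq_rpow, ← Real.sqrt_eq_rpow, Real.Gamma_add_one hx.ne',
    Real.sqrt_mul hx.le] at h
  have hG := (Real.Gamma_pos_of_pos hx).le
  calc Real.Gamma (x + 1 / 2) = Real.Gamma (1 / 2 * x + 1 / 2 * (x + 1)) := by ring_nf
    _ ≤ _ := h
    _ = Real.Gamma x * Real.sqrt x := by
      rw [mul_left_comm, Real.mul_self_sqrt hG, mul_comm]

theorem Gamma_add_half_mul_le {x M : ℝ} (hx : 0 < x) (j : ℕ) (h : x + j / 2 ≤ M + 1 / 2) :
    Real.Gamma (x + j / 2) ≤ Real.Gamma x * Real.sqrt M ^ j := by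
  induction j with
  | zero => simp
  | succ j ih =>
    push_cast at h ⊢
    have hG := (Real.Gamma_pos_of_pos hx).le
    have hpos : 0 < x + j / 2 := by positivity
    calc Real.Gamma (x + ((j : ℝ) + 1) / 2) = Real.Gamma (x + j / 2 + 1 / 2) := by ring_nf
      _ ≤ Real.Gamma (x + j / 2) * Real.sqrt (x + j / 2) := Gamma_add_half_le hpos
      _ ≤ (Real.Gamma x * Real.sqrt M ^ j) * Real.sqrt M := by
        gcongr
        · exact ih (by linarith)
        · linarith
      _ = _ := by ring

/-! ### Powers of a generating function with coefficients `1 / √(2πj)` -/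

open PowerSeries in
/-- The power series `(1 - X)^(-a)`. -/
noncomputable def invOneSubRpow (a : ℝ) : PowerSeries ℝ :=
  rescale (-1) (binomialSeries ℝ (-a))

theorem invOneSubRpow_pow (a : ℝ) (k : ℕ) : invOneSubRpow a ^ k = invOneSubRpow (k * a) := by
  induction k with
  | zero => simp [invOneSubRpow]
  | succ k ih =>
    rw [pow_succ, ih, invOneSubRpow, invOneSubRpow, invOneSubRpow, ← map_mul,
      ← PowerSeries.binomialSeries_add]
    congr 2
    push_cast
    ring

theorem Gamma_add_nat_eq_ascPochhammer {a : ℝ} (ha : 0 < a) (j : ℕ) :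
    Real.Gamma (a + j) = (ascPochhammer ℝ j).eval a * Real.Gamma a := by
  induction j with
  | zero => simp
  | succ j ih =>
    have hpos : 0 < a + j := by positivity
    rw [ascPochhammer_succ_eval, Nat.cast_succ, ← add_assoc, Real.Gamma_add_one hpos.ne', ih]
    ring

theorem coeff_invOneSubRpow {a : ℝ} (ha : 0 < a) (j : ℕ) :
    PowerSeries.coeff j (invOneSubRpow a) =
      Real.Gamma (a + j) / (Real.Gamma a * (j.factorial : ℝ)) := by
  have hG := (Real.Gamma_pos_of_pos ha).ne'
  have hj : (j.factorial : ℝ) ≠ 0 := by positivity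
  have h1 := Ring.factorial_nsmul_multichoose_eq_ascPochhammer a j
  rw [Polynomial.ascPochhammer_smeval_eq_eval, nsmul_eq_mul] at h1
  have h2 : ((-1 : ℝ)) ^ j * (-1) ^ j = 1 := by rw [← mul_pow]; simp
  rw [invOneSubRpow, PowerSeries.coeff_rescale, PowerSeries.binomialSeries_coeff,
    Ring.choose_neg', Gamma_add_nat_eq_ascPochhammer ha, ← h1, smul_eq_mul, mul_one,
    Units.smul_def, zsmul_eq_mul, Int.cast_negOnePow_natCast, ← mul_assoc, h2, one_mul]
  field_simp

/-- The series `∑_{j ≥ 1} X^j / √(2πj)`. -/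
noncomputable def stirlingSeries : PowerSeries ℝ :=
  PowerSeries.mk fun j => if j = 0 then 0 else 1 / Real.sqrt (2 * Real.pi * j)

theorem coeff_stirlingSeries_nonneg (j : ℕ) : 0 ≤ PowerSeries.coeff j stirlingSeries := by
  rw [stirlingSeries, PowerSeries.coeff_mk]
  split_ifs <;> positivity

/-- Both sides are asymptotically equal: the coefficient of `X^j` in `(1 - X)^(-1/2)` is
`Γ(j + 1/2) / (√π j!)`, which is about `1 / √(πj)`. -/
theorem coeff_stirlingSeries_le (j : ℕ) :
    PowerSeries.coeff j stirlingSeries ≤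
      PowerSeries.coeff j (PowerSeries.X * (PowerSeries.C (1 / Real.sqrt 2) *
        invOneSubRpow (1 / 2))) := by
  rcases j with _ | j
  · simp [stirlingSeries]
  have hpi := Real.pi_pos
  have hG : 0 < Real.Gamma (1 / 2 + j) := Real.Gamma_pos_of_pos (by positivity)
  have h := Gamma_add_half_le (x := 1 / 2 + j) (by positivity)
  rw [show (1 / 2 + (j : ℝ) + 1 / 2) = j + 1 by ring, Real.Gamma_nat_eq_factorial] at h
  have h2 : Real.sqrt (1 / 2 + j) ≤ Real.sqrt (j + 1) := Real.sqrt_le_sqrt (by linarith)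
  rw [PowerSeries.coeff_succ_X_mul, PowerSeries.coeff_C_mul, coeff_invOneSubRpow (by norm_num),
    stirlingSeries, PowerSeries.coeff_mk, if_neg (by omega), Real.Gamma_one_half_eq]
  push_cast
  rw [Real.sqrt_mul (by positivity), Real.sqrt_mul (by positivity), div_mul_div_comm, one_mul,
    div_le_div_iff₀ (by positivity) (by positivity)]
  have h3 : (j.factorial : ℝ) ≤ Real.Gamma (1 / 2 + j) * Real.sqrt (j + 1) :=
    h.trans (by gcongr)
  have : 0 < Real.sqrt 2 * Real.sqrt Real.pi := by positivity
  nlinarith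

theorem coeff_pow_le_coeff_pow {f g : PowerSeries ℝ} (hf : ∀ j, 0 ≤ PowerSeries.coeff j f)
    (hfg : ∀ j, PowerSeries.coeff j f ≤ PowerSeries.coeff j g) (k j : ℕ) :
    PowerSeries.coeff j (f ^ k) ≤ PowerSeries.coeff j (g ^ k) := by
  rw [PowerSeries.coeff_pow, PowerSeries.coeff_pow]
  exact Finset.sum_le_sum fun l _ => Finset.prod_le_prod (fun i _ => hf _) fun i _ => hfg _

/-- The sum of `∏ 1 / √(2πνᵢ)` over the positive compositions `ν` of `n` into `k` parts is at
most the corresponding Dirichlet integral. -/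
theorem coeff_stirlingSeries_pow_le {n k : ℕ} (hn : 1 ≤ n) (hk : 1 ≤ k) :
    PowerSeries.coeff n (stirlingSeries ^ k) ≤
      (1 / Real.sqrt 2) ^ k * Real.sqrt n ^ k / (n * Real.Gamma ((k : ℝ) / 2)) := by
  have hpi := Real.pi_pos
  have hn0 : (0 : ℝ) < n := by exact_mod_cast hn
  have hk0 : (0 : ℝ) < k := by exact_mod_cast hk
  have hGk : 0 < Real.Gamma ((k : ℝ) / 2) := Real.Gamma_pos_of_pos (by positivity)
  obtain rfl | hk2 := hk.eq_or_lt
  · rw [pow_one, stirlingSeries, PowerSeries.coeff_mk, if_neg (by omega), pow_one, pow_one,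
      Nat.cast_one, Real.Gamma_one_half_eq, Real.sqrt_mul (by positivity),
      Real.sqrt_mul (by positivity)]
    apply le_of_eq
    have hs := Real.mul_self_sqrt hn0.le
    have hsn : 0 < Real.sqrt n := Real.sqrt_pos.2 hn0
    field_simp
    nlinarith
  · refine (coeff_pow_le_coeff_pow coeff_stirlingSeries_nonneg coeff_stirlingSeries_le
      k n).trans ?_
    rw [mul_pow, mul_pow, invOneSubRpow_pow, ← map_pow, PowerSeries.coeff_X_pow_mul']
    split_ifs with hkn
    · rw [PowerSeries.coeff_C_mul, coeff_invOneSubRpow (by positivity), mul_div_assoc]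
      refine mul_le_mul_of_nonneg_left ?_ (by positivity)
      obtain ⟨j, rfl⟩ := Nat.exists_eq_add_of_le hk2
      obtain ⟨l, rfl⟩ := Nat.exists_eq_add_of_le hkn
      have h := Gamma_add_half_mul_le (x := (l : ℝ) + 1) (M := ((1 + 1 + j + l : ℕ) : ℝ))
        (by positivity) j (by push_cast; linarith)
      rw [Real.Gamma_nat_eq_factorial] at h
      have e : ((1 + 1 + j : ℕ) : ℝ) * (1 / 2) + ((1 + 1 + j + l - (1 + 1 + j) : ℕ) : ℝ) =
          (l : ℝ) + 1 + j / 2 := by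
        rw [Nat.add_sub_cancel_left]; push_cast; ring
      simp only [Nat.succ_eq_add_one] at *
      rw [e, Nat.add_sub_cancel_left, show ((1 + 1 + j : ℕ) : ℝ) * (1 / 2) =
        ((1 + 1 + j : ℕ) : ℝ) / 2 by ring]
      rw [div_le_div_iff₀ (by positivity) (by positivity), pow_add, pow_add, pow_one,
        Real.mul_self_sqrt hn0.le]
      have hh : 0 ≤ ((1 + 1 + j + l : ℕ) : ℝ) * Real.Gamma (((1 + 1 + j : ℕ) : ℝ) / 2) := by
        positivity
      have := mul_le_mul_of_nonneg_right h hh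
      linarith
    · positivity

theorem sum_piAntidiag_prod_coeff {m : ℕ} (f : PowerSeries ℝ) (n : ℕ) :
    ∑ ν ∈ Finset.piAntidiag (Finset.univ : Finset (Fin m)) n,
      ∏ i, PowerSeries.coeff (ν i) f = PowerSeries.coeff n (f ^ m) := by
  have h := PowerSeries.coeff_prod (fun _ : Fin m => f) n Finset.univ
  rw [Finset.prod_const, Finset.card_univ, Fintype.card_fin] at h
  rw [h]
  refine (Finset.sum_bij (fun (l : Fin m →₀ ℕ) _ => (l : Fin m → ℕ)) ?_ ?_ ?_ ?_).symm
  · intro l hl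
    simpa using hl
  · intro a _ b _ hab
    exact DFunLike.coe_injective hab
  · intro ν hν
    refine ⟨Finsupp.equivFunOnFinite.symm ν, ?_, by simp⟩
    simpa using hν
  · intros
    rfl

/-- The bound `K ∑_{k=1}^m C(m,k) √m^(m-k) √n^(k-1)` with `K = √(2π) / (√2^m Γ(m/2))`, for the sum
of the Stirling weights of all count vectors with sum `n`; the summation index is `k - 1`. -/
noncomputable def levelBound (m n : ℕ) : ℝ :=
  Real.sqrt (2 * Real.pi) / (Real.sqrt 2 ^ m * Real.Gamma ((m : ℝ) / 2)) *
    ∑ k ∈ Finset.range m, (m.choose (k + 1) : ℝ) * Real.sqrt m ^ (m - (k + 1)) * Real.sqrt n ^ k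

theorem sqrt_mul_coeff_le_levelBound {m n : ℕ} (hm : 1 ≤ m) (hn : 1 ≤ n) :
    Real.sqrt (2 * Real.pi * n) * PowerSeries.coeff n ((1 + stirlingSeries) ^ m) ≤
      levelBound m n := by
  have hpi := Real.pi_pos
  have hn0 : (0 : ℝ) < n := by exact_mod_cast hn
  have hm0 : (0 : ℝ) < m := by exact_mod_cast hm
  have hGm : 0 < Real.Gamma ((m : ℝ) / 2) := Real.Gamma_pos_of_pos (by positivity)
  rw [add_comm, add_pow, map_sum, Finset.sum_range_succ', levelBound, Finset.mul_sum, mul_add]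
  have h0 : PowerSeries.coeff n (stirlingSeries ^ 0 * 1 ^ (m - 0) * (m.choose 0 : PowerSeries ℝ))
      = 0 := by
    simp [PowerSeries.coeff_one, show n ≠ 0 by omega]
  rw [h0, mul_zero, add_zero, Finset.mul_sum]
  refine Finset.sum_le_sum fun k hk => ?_
  have hkm : k + 1 ≤ m := Finset.mem_range.1 hk
  have hGk : 0 < Real.Gamma (((k + 1 : ℕ) : ℝ) / 2) := Real.Gamma_pos_of_pos (by positivity)
  have e : PowerSeries.coeff n (stirlingSeries ^ (k + 1) * 1 ^ (m - (k + 1)) *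
      (m.choose (k + 1) : PowerSeries ℝ)) =
      m.choose (k + 1) * PowerSeries.coeff n (stirlingSeries ^ (k + 1)) := by
    rw [one_pow, mul_one, mul_comm, ← map_natCast (PowerSeries.C (R := ℝ)),
      PowerSeries.coeff_C_mul]
  rw [e]
  have h1 := coeff_stirlingSeries_pow_le hn (Nat.succ_pos k : 1 ≤ k + 1)
  obtain ⟨j, rfl⟩ := Nat.exists_eq_add_of_le hkm
  -- Replacing `Γ((k+1)/2)` by `Γ(m/2)` costs a factor `√(m/2)` for each of the `j` half steps.
  have h2 := Gamma_add_half_mul_le (x := ((k + 1 : ℕ) : ℝ) / 2)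
    (M := ((k + 1 + j : ℕ) : ℝ) / 2) (by positivity) j (by push_cast; linarith)
  rw [show ((k + 1 : ℕ) : ℝ) / 2 + (j : ℝ) / 2 = ((k + 1 + j : ℕ) : ℝ) / 2 by push_cast; ring,
    Real.sqrt_div (by positivity), div_pow] at h2
  rw [Nat.add_sub_cancel_left]
  set c : ℝ := ((k + 1 + j).choose (k + 1) : ℝ)
  set A := Real.Gamma (((k + 1 : ℕ) : ℝ) / 2)
  set B := Real.Gamma (((k + 1 + j : ℕ) : ℝ) / 2)
  set M := Real.sqrt ((k + 1 + j : ℕ) : ℝ)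
  have hs2 : 0 < Real.sqrt 2 := by positivity
  have hsn : 0 < Real.sqrt n := Real.sqrt_pos.2 hn0
  have hnn := Real.mul_self_sqrt hn0.le
  have hB : 1 / A ≤ M ^ j / Real.sqrt 2 ^ j / B := by
    rw [div_le_div_iff₀ hGk hGm]
    linarith
  calc Real.sqrt (2 * Real.pi * n) *
        (c * PowerSeries.coeff n (stirlingSeries ^ (k + 1)))
      ≤ Real.sqrt (2 * Real.pi * n) * (c * ((1 / Real.sqrt 2) ^ (k + 1) *
          Real.sqrt n ^ (k + 1) / (n * A))) := by gcongr
    _ = Real.sqrt (2 * Real.pi) * c * (1 / Real.sqrt 2 ^ (k + 1)) * Real.sqrt n ^ k * (1 / A) := by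
        rw [Real.sqrt_mul (by positivity) (n : ℝ), one_div_pow]
        field_simp
        rw [pow_succ]
        linear_combination c * Real.sqrt n ^ k * hnn
    _ ≤ Real.sqrt (2 * Real.pi) * c * (1 / Real.sqrt 2 ^ (k + 1)) * Real.sqrt n ^ k *
          (M ^ j / Real.sqrt 2 ^ j / B) := by gcongr
    _ = _ := by
        rw [pow_add (Real.sqrt 2) (k + 1) j]
        field_simp

/-- The empty sequence is the only one of length `0`, so the level `n = 0` has weight `1`. -/
theorem one_le_levelBound_zero {m : ℕ} (hm : 1 ≤ m) : 1 ≤ levelBound m 0 := by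
  obtain ⟨j, rfl⟩ := Nat.exists_eq_add_of_le hm
  have hpi := Real.pi_pos
  have hGm : 0 < Real.Gamma (((1 + j : ℕ) : ℝ) / 2) := Real.Gamma_pos_of_pos (by positivity)
  have h := Gamma_add_half_mul_le (x := 1 / 2) (M := ((1 + j : ℕ) : ℝ) / 2) (by norm_num) j
    (by push_cast; linarith)
  rw [show (1 : ℝ) / 2 + (j : ℝ) / 2 = ((1 + j : ℕ) : ℝ) / 2 by push_cast; ring,
    Real.sqrt_div (by positivity), div_pow, Real.Gamma_one_half_eq] at h
  rw [levelBound, Finset.sum_eq_single 0]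
  · simp only [zero_add, Nat.choose_one_right, pow_zero, mul_one, Nat.add_sub_cancel_left]
    rw [div_mul_eq_mul_div, one_le_div (by positivity), Real.sqrt_mul (by positivity), pow_add,
      pow_one]
    have h1 : (1 : ℝ) ≤ ((1 + j : ℕ) : ℝ) := by push_cast; linarith [Nat.cast_nonneg (α := ℝ) j]
    have hs2 : 0 < Real.sqrt 2 := by positivity
    set M := Real.sqrt ((1 + j : ℕ) : ℝ)
    calc Real.sqrt 2 * Real.sqrt 2 ^ j * Real.Gamma (((1 + j : ℕ) : ℝ) / 2)
        ≤ Real.sqrt 2 * Real.sqrt 2 ^ j * (Real.sqrt Real.pi * (M ^ j / Real.sqrt 2 ^ j)) := by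
          gcongr
      _ = Real.sqrt 2 * Real.sqrt Real.pi * (1 * M ^ j) := by field_simp
      _ ≤ _ := by gcongr
  · intro k _ hk
    simp [hk]
  · intro h0
    simp at h0

/-! ### Sequences with a given count vector -/

theorem countVector_cons {m : ℕ} (i : Fin m) (σ : List (Fin m)) :
    countVector (i :: σ) = countVector σ + Pi.single i 1 := by
  funext j
  by_cases h : i = j
  · subst h; simp [countVector]
  · simp [countVector, h, Ne.symm h]

theorem finite_countVector_eq {m : ℕ} (ν : Fin m → ℕ) :
    {σ : List (Fin m) | countVector σ = ν}.Finite :=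
  finite_realizations (S := {ν}) (n := ∑ i, ν i) (by rintro _ rfl; exact le_rfl)

theorem numRealizations_singleton_eq_sum {m : ℕ} {ν : Fin m → ℕ} (hν : ν ≠ 0) :
    numRealizations {ν} = ∑ i, {σ : List (Fin m) | countVector σ + Pi.single i 1 = ν}.ncard := by
  have hU : {σ : List (Fin m) | countVector σ ∈ ({ν} : Set (Fin m → ℕ))} =
      ⋃ i, (List.cons i) '' {σ : List (Fin m) | countVector σ + Pi.single i 1 = ν} := by
    ext σ
    simp only [Set.mem_singleton_iff, Set.mem_ofPred_eq, Set.mem_iUnion, Set.mem_image]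
    constructor
    · intro h
      cases σ with
      | nil => exact absurd (h.symm.trans (by funext j; simp [countVector])) hν
      | cons i τ => exact ⟨i, τ, by rw [← countVector_cons, h], rfl⟩
    · rintro ⟨i, τ, h, rfl⟩
      rw [countVector_cons, h]
  have hfin (i : Fin m) : {σ : List (Fin m) | countVector σ + Pi.single i 1 = ν}.Finite := by
    refine Set.Finite.of_finite_image (f := List.cons i) ?_ (List.cons_injective.injOn)
    refine (finite_countVector_eq ν).subset ?_
    rintro _ ⟨τ, h, rfl⟩
    exact (countVector_cons i τ).trans h
  rw [numRealizations, hU, Set.ncard_iUnion_of_finite (fun i => (hfin i).image _),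
    finsum_eq_sum_of_fintype]
  · exact Finset.sum_congr rfl fun i _ => Set.ncard_image_of_injective _ List.cons_injective
  · intro i j hij
    refine Set.disjoint_left.2 ?_
    rintro _ ⟨τ, _, rfl⟩ ⟨τ', _, h⟩
    exact hij (List.cons.inj h).1.symm

/-- The number of realizations is the multinomial coefficient; it satisfies the recursion given by
the first element of the sequence. -/
theorem numRealizations_singleton_mul {m : ℕ} (ν : Fin m → ℕ) :
    numRealizations {ν} * ∏ i, (ν i).factorial = (∑ i, ν i).factorial := by
  induction hn : ∑ i, ν i generalizing ν with
  | zero =>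
    have h0 : ν = 0 := by
      funext i
      exact (Finset.sum_eq_zero_iff.1 hn) i (Finset.mem_univ i)
    subst h0
    have : {σ : List (Fin m) | countVector σ ∈ ({0} : Set (Fin m → ℕ))} = {[]} := by
      ext σ
      simp only [Set.mem_singleton_iff, Set.mem_ofPred_eq]
      constructor
      · intro h
        cases σ with
        | nil => rfl
        | cons i τ =>
          have := congrFun h i
          simp [countVector] at this
      · rintro rfl
        funext j
        simp [countVector]
    rw [numRealizations, this]
    simp
  | succ n ih =>
    have hν : ν ≠ 0 := by
      rintro rfl
      simp at hn
    rw [numRealizations_singleton_eq_sum hν, Finset.sum_mul]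
    have key (i : Fin m) : {σ : List (Fin m) | countVector σ + Pi.single i 1 = ν}.ncard *
        ∏ j, (ν j).factorial = ν i * n.factorial := by
      rcases Nat.eq_zero_or_pos (ν i) with h | h
      · have : {σ : List (Fin m) | countVector σ + Pi.single i 1 = ν} = ∅ := by
          ext σ
          simp only [Set.mem_ofPred_eq, Set.mem_empty_iff_false, iff_false]
          intro hσ
          have := congrFun hσ i
          simp [h] at this
        rw [this, h]
        simp
      · obtain ⟨μ, rfl⟩ : ∃ μ : Fin m → ℕ, ν = μ + Pi.single i 1 := by
          refine ⟨ν - Pi.single i 1, ?_⟩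
          funext j
          by_cases hj : j = i
          · subst hj; simp; omega
          · simp [hj]
        have hs : ∑ j, μ j = n := by
          simp only [Pi.add_apply, Finset.sum_add_distrib, Finset.sum_pi_single',
            Finset.mem_univ, if_true] at hn
          have h1 : ∑ j, (Pi.single i 1 : Fin m → ℕ) j = 1 := by simp
          omega
        have h1 : ∏ j, ((μ + Pi.single i 1 : Fin m → ℕ) j).factorial =
            (μ i + 1) * ∏ j, (μ j).factorial := by
          rw [← Finset.mul_prod_erase _ _ (Finset.mem_univ i),
            ← Finset.mul_prod_erase Finset.univ (fun j => (μ j).factorial) (Finset.mem_univ i)]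
          have : ∏ j ∈ Finset.univ.erase i, ((μ + Pi.single i 1 : Fin m → ℕ) j).factorial =
              ∏ j ∈ Finset.univ.erase i, (μ j).factorial :=
            Finset.prod_congr rfl fun j hj => by simp [Finset.ne_of_mem_erase hj]
          rw [this]
          simp [Nat.factorial_succ, mul_assoc]
        have h2 : {σ : List (Fin m) | countVector σ + Pi.single i 1 = μ + Pi.single i 1}.ncard =
            numRealizations {μ} := by
          simp [numRealizations]
        rw [h1, h2, mul_left_comm, ih μ hs]
        simp
    rw [Finset.sum_congr rfl fun i _ => key i, ← Finset.sum_mul, hn, Nat.factorial_succ]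

theorem numRealizations_eq_sum {m : ℕ} (S : Finset (Fin m → ℕ)) :
    numRealizations (S : Set (Fin m → ℕ)) = ∑ ν ∈ S, numRealizations {ν} := by
  have hU : {σ : List (Fin m) | countVector σ ∈ (S : Set (Fin m → ℕ))} =
      ⋃ ν ∈ (S : Set (Fin m → ℕ)), {σ : List (Fin m) | countVector σ = ν} := by
    ext σ
    simp
  rw [numRealizations, hU, S.finite_toSet.ncard_biUnion (fun ν _ => finite_countVector_eq ν),
    finsum_mem_coe_finset]
  · rfl
  · intro ν _ μ _ h
    refine Set.disjoint_left.2 fun σ h1 h2 => h ?_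
    exact h1.symm.trans h2

/-! ### Stirling bounds for multinomial coefficients -/

/-- The quotient of `j!` by `(j/e)^j`; it is `1` for `j = 0`. -/
noncomputable def stirlingFactor (j : ℕ) : ℝ :=
  j.factorial * Real.exp j / (j : ℝ) ^ j

theorem stirlingFactor_pos (j : ℕ) : 0 < stirlingFactor j := by
  rcases Nat.eq_zero_or_pos j with rfl | h
  · simp [stirlingFactor]
  · have : (0 : ℝ) < j := by exact_mod_cast h
    unfold stirlingFactor
    positivity

theorem stirlingFactor_eq {j : ℕ} (hj : 1 ≤ j) :
    stirlingFactor j = Stirling.stirlingSeq j * (Real.sqrt 2 * Real.sqrt j) := by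
  have : (0 : ℝ) < j := by exact_mod_cast hj
  rw [stirlingFactor, Stirling.stirlingSeq, ← Real.sqrt_mul (by norm_num), div_pow,
    ← Real.exp_nat_mul, mul_one]
  field_simp

theorem stirlingSeq_le_of_le {j n : ℕ} (hj : 1 ≤ j) (hjn : j ≤ n) :
    Stirling.stirlingSeq n ≤ Stirling.stirlingSeq j := by
  have h := Stirling.stirlingSeq'_antitone (show j - 1 ≤ n - 1 by omega)
  simpa [Nat.succ_eq_add_one, Nat.sub_add_cancel hj, Nat.sub_add_cancel (hj.trans hjn)] using h

theorem sqrt_le_stirlingFactor {j : ℕ} (hj : 1 ≤ j) :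
    Real.sqrt (2 * Real.pi * j) ≤ stirlingFactor j := by
  have hpi := Real.pi_pos
  rw [stirlingFactor_eq hj, mul_comm 2 Real.pi, mul_assoc, Real.sqrt_mul hpi.le,
    Real.sqrt_mul (by norm_num)]
  gcongr
  exact Stirling.sqrt_pi_le_stirlingSeq (by omega)

theorem exp_one_lt : Real.exp 1 < Real.exp (1 / 12) * Real.sqrt (2 * Real.pi) := by
  have h1 : Real.exp (11 / 12) ^ 2 < 2 * Real.pi := by
    rw [← Real.exp_nat_mul]
    have he := Real.exp_one_lt_d9
    have hpi := Real.pi_gt_d6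
    -- The claim is `e^(11/6) < 2π`; its sixth power has an integral power of `e`.
    have h6 : Real.exp (((2 : ℕ) : ℝ) * (11 / 12)) ^ 6 < (2 * Real.pi) ^ 6 := by
      rw [← Real.exp_nat_mul, show ((6 : ℕ) : ℝ) * (((2 : ℕ) : ℝ) * (11 / 12)) = ((11 : ℕ) : ℝ) * 1
        by norm_num, Real.exp_nat_mul]
      calc Real.exp 1 ^ 11 < 2.7182818286 ^ 11 := by gcongr
        _ < (2 * 3.141592) ^ 6 := by norm_num
        _ < _ := by gcongr
    exact lt_of_pow_lt_pow_left₀ 6 (by positivity) h6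
  have h2 : Real.exp (11 / 12) < Real.sqrt (2 * Real.pi) := Real.lt_sqrt_of_sq_lt h1
  calc Real.exp 1 = Real.exp (1 / 12) * Real.exp (11 / 12) := by
        rw [← Real.exp_add]; norm_num
    _ < _ := by gcongr

/-- The ratio `j! / (√(2πj) (j/e)^j)` is decreasing in `j`, so it is at most its value
`e / √(2π)` at `j = 1`, which is below `e^(1/12)`. -/
theorem stirlingFactor_le {j : ℕ} (hj : 1 ≤ j) :
    stirlingFactor j ≤ Real.exp (1 / 12) * Real.sqrt (2 * Real.pi * j) := by
  have hpi := Real.pi_pos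
  have h2 : 0 < Real.sqrt 2 := by positivity
  have h := stirlingSeq_le_of_le le_rfl hj
  rw [Stirling.stirlingSeq_one] at h
  rw [stirlingFactor_eq hj, Real.sqrt_mul (by positivity), ← mul_assoc, ← mul_assoc]
  refine mul_le_mul_of_nonneg_right ?_ (Real.sqrt_nonneg _)
  calc Stirling.stirlingSeq j * Real.sqrt 2 ≤ Real.exp 1 / Real.sqrt 2 * Real.sqrt 2 := by gcongr
    _ = Real.exp 1 := by field_simp
    _ ≤ _ := exp_one_lt.le

theorem exp_natCast_mul_log (j : ℕ) : Real.exp (j * Real.log j) = (j : ℝ) ^ j := by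
  rcases Nat.eq_zero_or_pos j with rfl | h
  · simp
  · rw [Real.exp_nat_mul, Real.exp_log (by exact_mod_cast h)]

theorem numRealizations_mul_stirlingFactor {m : ℕ} (ν : Fin m → ℕ) :
    (numRealizations {ν} : ℝ) * ∏ i, stirlingFactor (ν i) =
      Real.exp (genEntropy fun i => (ν i : ℝ)) * stirlingFactor (∑ i, ν i) := by
  have h : (numRealizations {ν} : ℝ) * ∏ i, ((ν i).factorial : ℝ) = (∑ i, ν i).factorial := by
    exact_mod_cast numRealizations_singleton_mul ν
  have hpos (j : ℕ) : (0 : ℝ) < (j : ℝ) ^ j := by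
    rw [← exp_natCast_mul_log]; positivity
  have hprod : 0 < ∏ i, (ν i : ℝ) ^ (ν i) := Finset.prod_pos fun i _ => hpos _
  have hG : Real.exp (genEntropy fun i => (ν i : ℝ)) =
      (((∑ i, ν i : ℕ) : ℝ) ^ (∑ i, ν i)) / ∏ i, (ν i : ℝ) ^ (ν i) := by
    rw [genEntropy, neg_add_eq_sub, Real.exp_sub, Real.exp_sum, ← Nat.cast_sum,
      exp_natCast_mul_log]
    simp only [exp_natCast_mul_log]
  have hn := (hpos (∑ i, ν i)).ne'
  simp only [stirlingFactor]
  rw [hG, ← h, Finset.prod_div_distrib, Finset.prod_mul_distrib, ← Real.exp_sum, Nat.cast_sum]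
  rw [Nat.cast_sum] at hn
  field_simp

theorem coeff_one_add_stirlingSeries (j : ℕ) :
    PowerSeries.coeff j (1 + stirlingSeries) =
      if j = 0 then 1 else 1 / Real.sqrt (2 * Real.pi * j) := by
  rw [map_add, PowerSeries.coeff_one, stirlingSeries, PowerSeries.coeff_mk]
  split_ifs <;> simp

theorem one_le_stirlingFactor_mul_coeff (j : ℕ) :
    1 ≤ stirlingFactor j * PowerSeries.coeff j (1 + stirlingSeries) := by
  rw [coeff_one_add_stirlingSeries]
  split_ifs with h
  · simp [h, stirlingFactor]
  · have hj : (0 : ℝ) < j := by exact_mod_cast Nat.pos_of_ne_zero h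
    have hpi := Real.pi_pos
    rw [mul_one_div, one_le_div (by positivity)]
    exact sqrt_le_stirlingFactor (Nat.one_le_iff_ne_zero.2 h)

/-- The correction factors of Stirling's formula for `n!` and for one of the `νᵢ!` are compared
by monotonicity; those of the other factorials are at least `1`. -/
theorem stirlingFactor_sum_le {m : ℕ} (ν : Fin m → ℕ) (hν : 1 ≤ ∑ i, ν i) :
    stirlingFactor (∑ i, ν i) ≤ Real.sqrt (2 * Real.pi * (∑ i, ν i : ℕ)) *
      ((∏ i, PowerSeries.coeff (ν i) (1 + stirlingSeries)) * ∏ i, stirlingFactor (ν i)) := by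
  obtain ⟨i, hi⟩ : ∃ i, ν i ≠ 0 := by
    by_contra! h
    simp [h] at hν
  have hi1 : 1 ≤ ν i := Nat.one_le_iff_ne_zero.2 hi
  have hin : ν i ≤ ∑ i, ν i := Finset.single_le_sum (fun _ _ => Nat.zero_le _) (Finset.mem_univ i)
  set n := ∑ i, ν i
  have hpi := Real.pi_pos
  have hi0 : (0 : ℝ) < ν i := by exact_mod_cast hi1
  rw [← Finset.prod_mul_distrib, ← Finset.mul_prod_erase _ _ (Finset.mem_univ i), ← mul_assoc]
  have h1 : 1 ≤ ∏ j ∈ Finset.univ.erase i,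
      PowerSeries.coeff (ν j) (1 + stirlingSeries) * stirlingFactor (ν j) := by
    rw [← Finset.prod_const_one (s := Finset.univ.erase i)]
    refine Finset.prod_le_prod (fun _ _ => zero_le_one) fun j _ => ?_
    rw [mul_comm]
    exact one_le_stirlingFactor_mul_coeff _
  have h2 : stirlingFactor n ≤ Real.sqrt (2 * Real.pi * n) *
      (PowerSeries.coeff (ν i) (1 + stirlingSeries) * stirlingFactor (ν i)) := by
    rw [coeff_one_add_stirlingSeries, if_neg hi, stirlingFactor_eq hi1, stirlingFactor_eq hν,
      Real.sqrt_mul (by positivity) (n : ℝ), Real.sqrt_mul (by positivity) (ν i : ℝ)]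
    have := stirlingSeq_le_of_le hi1 hin
    have hs : 0 < Real.sqrt (ν i) := Real.sqrt_pos.2 hi0
    calc Stirling.stirlingSeq n * (Real.sqrt 2 * Real.sqrt n)
        ≤ Stirling.stirlingSeq (ν i) * (Real.sqrt 2 * Real.sqrt n) := by gcongr
      _ = _ := by field_simp
  have h3 := (stirlingFactor_pos n).le.trans h2
  calc stirlingFactor n ≤ _ := h2
    _ ≤ _ := le_mul_of_one_le_right h3 h1

/-- On the sequences of length `n`, the weights `exp (-G)` of their count vectors have bounded sum. -/
theorem sum_level_le {m n : ℕ} (hm : 1 ≤ m) :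
    ∑ ν ∈ Finset.piAntidiag (Finset.univ : Finset (Fin m)) n,
      (numRealizations {ν} : ℝ) * Real.exp (-genEntropy fun i => (ν i : ℝ)) ≤ levelBound m n := by
  have key (ν : Fin m → ℕ) : (numRealizations {ν} : ℝ) *
      Real.exp (-genEntropy fun i => (ν i : ℝ)) =
      stirlingFactor (∑ i, ν i) / ∏ i, stirlingFactor (ν i) := by
    have hp : 0 < ∏ i, stirlingFactor (ν i) := Finset.prod_pos fun i _ => stirlingFactor_pos _
    have he := Real.exp_pos (genEntropy fun i => (ν i : ℝ))
    rw [eq_div_iff hp.ne', mul_right_comm, numRealizations_mul_stirlingFactor, Real.exp_neg]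
    field_simp
  rcases Nat.eq_zero_or_pos n with rfl | hn
  · rw [Finset.piAntidiag_zero, Finset.sum_singleton, key]
    simpa [stirlingFactor] using one_le_levelBound_zero hm
  · refine le_trans ?_ (sqrt_mul_coeff_le_levelBound hm hn)
    rw [← sum_piAntidiag_prod_coeff, Finset.mul_sum]
    refine Finset.sum_le_sum fun ν hν => ?_
    have hs : ∑ i, ν i = n := (Finset.mem_piAntidiag.1 hν).1
    have hp : 0 < ∏ i, stirlingFactor (ν i) := Finset.prod_pos fun i _ => stirlingFactor_pos _
    rw [key, div_le_iff₀ hp, mul_assoc]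
    have h := stirlingFactor_sum_le ν (by omega)
    rwa [hs] at h ⊢

/-- Stirling's lower bound for a multinomial coefficient with positive entries. -/
theorem le_numRealizations_singleton {m : ℕ} (hm : 1 ≤ m) (ν : Fin m → ℕ) (hν : ∀ i, 1 ≤ ν i) :
    Real.exp (-(m : ℝ) / 12) * Real.sqrt (2 * Real.pi) * (1 / Real.sqrt (2 * Real.pi)) ^ m *
      (Real.exp (genEntropy fun i => (ν i : ℝ)) *
        (Real.sqrt (∑ i, (ν i : ℝ)) * ∏ i, (1 / Real.sqrt (ν i)))) ≤ numRealizations {ν} := by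
  have hpi := Real.pi_pos
  have hp : 0 < ∏ i, stirlingFactor (ν i) := Finset.prod_pos fun i _ => stirlingFactor_pos _
  have hn : 1 ≤ ∑ i, ν i :=
    (hν ⟨0, hm⟩).trans (Finset.single_le_sum (fun _ _ => Nat.zero_le _) (Finset.mem_univ _))
  refine le_of_mul_le_mul_right ?_ hp
  rw [numRealizations_mul_stirlingFactor]
  have h1 : ∏ i, stirlingFactor (ν i) ≤
      Real.exp ((m : ℝ) / 12) * Real.sqrt (2 * Real.pi) ^ m * ∏ i, Real.sqrt (ν i) := by
    calc ∏ i, stirlingFactor (ν i)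
        ≤ ∏ i, Real.exp (1 / 12) * (Real.sqrt (2 * Real.pi) * Real.sqrt (ν i)) := by
          refine Finset.prod_le_prod (fun i _ => (stirlingFactor_pos _).le) fun i _ => ?_
          rw [← Real.sqrt_mul (by positivity)]
          exact stirlingFactor_le (hν i)
      _ = _ := by
          rw [Finset.prod_mul_distrib, Finset.prod_mul_distrib, Finset.prod_const,
            Finset.prod_const, Finset.card_univ, Fintype.card_fin, ← Real.exp_nat_mul, mul_assoc]
          ring_nf
  have h2 := sqrt_le_stirlingFactor hn
  have hq : 0 < ∏ i, Real.sqrt (ν i) := Finset.prod_pos fun i _ =>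
    Real.sqrt_pos.2 (by exact_mod_cast hν i)
  rw [Real.sqrt_mul (by positivity), Nat.cast_sum] at h2
  have he : Real.exp (-(m : ℝ) / 12) * Real.exp ((m : ℝ) / 12) = 1 := by
    rw [← Real.exp_add]; ring_nf; simp
  calc _ ≤ Real.exp (-(m : ℝ) / 12) * Real.sqrt (2 * Real.pi) * (1 / Real.sqrt (2 * Real.pi)) ^ m *
      (Real.exp (genEntropy fun i => (ν i : ℝ)) *
        (Real.sqrt (∑ i, (ν i : ℝ)) * ∏ i, (1 / Real.sqrt (ν i)))) *
        (Real.exp ((m : ℝ) / 12) * Real.sqrt (2 * Real.pi) ^ m * ∏ i, Real.sqrt (ν i)) := by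
        have : 0 ≤ ∏ i, (1 / Real.sqrt (ν i)) := Finset.prod_nonneg fun i _ => by positivity
        gcongr
    _ = (Real.exp (-(m : ℝ) / 12) * Real.exp ((m : ℝ) / 12)) *
        (Real.exp (genEntropy fun i => (ν i : ℝ)) *
          (Real.sqrt (2 * Real.pi) * Real.sqrt (∑ i, (ν i : ℝ)))) := by
        rw [Finset.prod_div_distrib, Finset.prod_const_one, one_div_pow]
        field_simp
    _ ≤ _ := by
        rw [he, one_mul]
        gcongr

/-! ### Summation over the levels -/

theorem add_mul_le_pow_of_le {a b : ℝ} (ha : 0 ≤ a) (hab : a ≤ b) (k : ℕ) :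
    a ^ (k + 2) + (b - a) * (a ^ (k + 1) + (k + 1) * (b * a ^ k)) ≤ b ^ (k + 2) := by
  induction k with
  | zero => simp; nlinarith
  | succ k ih =>
    have hb := ha.trans hab
    have h := mul_le_mul_of_nonneg_left ih hb
    have h1 : 0 ≤ a ^ k * ((b - a) * ((k + 1) * (b * (b - a)))) := by
      have := sub_nonneg.2 hab
      positivity
    push_cast
    calc _ ≤ b * (a ^ (k + 2) + (b - a) * (a ^ (k + 1) + (k + 1) * (b * a ^ k))) := by
          ring_nf at h1 ⊢
          linarith
      _ ≤ _ := h
      _ = _ := by ring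

/-- The inequality `t a^k ≤ t^(k+1)`, integrated over `[a, b]`. -/
theorem mul_pow_le_pow_sub_pow {a b : ℝ} (ha : 0 ≤ a) (hab : a ≤ b) (k : ℕ) :
    (k + 2) * ((b ^ 2 - a ^ 2) * a ^ k) ≤ 2 * (b ^ (k + 2) - a ^ (k + 2)) := by
  have h := add_mul_le_pow_of_le ha hab k
  have h1 : 0 ≤ (k : ℝ) * ((b - a) * ((b - a) * a ^ k)) := by
    have := sub_nonneg.2 hab
    positivity
  ring_nf at h h1 ⊢
  linarith

theorem levelBound_le_sub {m : ℕ} (hm : 1 ≤ m) (n : ℕ) :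
    levelBound m n ≤
      Real.sqrt (2 * Real.pi) / (Real.sqrt 2 ^ m * Real.Gamma ((m : ℝ) / 2)) * (2 / (m + 1)) *
        ((Real.sqrt m + Real.sqrt (n + 1 : ℕ)) ^ (m + 1) -
          (Real.sqrt m + Real.sqrt n) ^ (m + 1)) := by
  have hm0 : (0 : ℝ) < m := by exact_mod_cast hm
  have hGm : 0 < Real.Gamma ((m : ℝ) / 2) := Real.Gamma_pos_of_pos (by positivity)
  rw [levelBound, mul_assoc]
  refine mul_le_mul_of_nonneg_left ?_ (by positivity)
  have ha := Real.sqrt_nonneg (n : ℝ)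
  have hab : Real.sqrt (n : ℝ) ≤ Real.sqrt (n + 1 : ℕ) := Real.sqrt_le_sqrt (by push_cast; linarith)
  have hsq : Real.sqrt (n + 1 : ℕ) ^ 2 - Real.sqrt n ^ 2 = 1 := by
    rw [Real.sq_sqrt (by positivity), Real.sq_sqrt (by positivity)]; push_cast; ring
  set a := Real.sqrt (n : ℝ)
  set b := Real.sqrt (n + 1 : ℕ)
  set c := Real.sqrt (m : ℝ)
  have hc : 0 ≤ c := Real.sqrt_nonneg _
  rw [add_comm c b, add_comm c a, add_pow, add_pow, ← Finset.sum_sub_distrib,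
    Finset.sum_range_succ', Finset.sum_range_succ']
  simp only [pow_zero, sub_self, add_zero, zero_add, pow_one]
  -- The term with exponent `1` in `a`, `b` is dropped.
  have h1 : 0 ≤ b * c ^ (m + 1 - 1) * ((m + 1).choose 1 : ℝ) -
      a * c ^ (m + 1 - 1) * ((m + 1).choose 1 : ℝ) := by
    rw [← sub_mul, ← sub_mul]
    have := sub_nonneg.2 hab
    positivity
  refine le_trans ?_ (mul_le_mul_of_nonneg_left (le_add_of_nonneg_right h1) (by positivity))
  rw [Finset.mul_sum]
  refine Finset.sum_le_sum fun k hk => ?_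
  have h := mul_pow_le_pow_sub_pow ha hab k
  rw [hsq, one_mul] at h
  have hch : ((m : ℝ) + 1) * m.choose (k + 1) = (m + 1).choose (k + 1 + 1) * (k + 2) := by
    have := Nat.add_one_mul_choose_eq m (k + 1)
    have h2 : (((m + 1) * m.choose (k + 1) : ℕ) : ℝ) =
      (((m + 1).choose (k + 1 + 1) * (k + 1 + 1) : ℕ) : ℝ) := by rw [this]
    push_cast at h2
    rw [h2]; ring
  have hch' : (m.choose (k + 1) : ℝ) = (m + 1).choose (k + 1 + 1) * (k + 2) / (m + 1) := by
    rw [← hch]; field_simp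
  rw [hch', show m + 1 - (k + 1 + 1) = m - (k + 1) by omega]
  calc _ = ((m + 1).choose (k + 1 + 1) : ℝ) * c ^ (m - (k + 1)) / (m + 1) * ((k + 2) * a ^ k) := by
        ring
    _ ≤ ((m + 1).choose (k + 1 + 1) : ℝ) * c ^ (m - (k + 1)) / (m + 1) *
        (2 * (b ^ (k + 2) - a ^ (k + 2))) := by gcongr
    _ = _ := by ring

theorem sum_levelBound_le {m : ℕ} (hm : 1 ≤ m) {n₁ n₂ : ℕ} (h : n₁ ≤ n₂) :
    ∑ n ∈ Finset.Icc n₁ n₂, levelBound m n ≤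
      Real.sqrt (2 * Real.pi) / (Real.sqrt 2 ^ m * Real.Gamma ((m : ℝ) / 2)) * (2 / (m + 1)) *
        ((Real.sqrt m + Real.sqrt (n₂ + 1 : ℕ)) ^ (m + 1) -
          (Real.sqrt m + Real.sqrt n₁) ^ (m + 1)) := by
  refine (Finset.sum_le_sum fun n _ => levelBound_le_sub hm n).trans (le_of_eq ?_)
  rw [← Finset.mul_sum, ← Finset.Ico_succ_right_eq_Icc]
  congr 1
  exact Finset.sum_Ico_sub (fun n : ℕ => (Real.sqrt m + Real.sqrt (n : ℝ)) ^ (m + 1)) (by simp; omega)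

theorem numRealizations_le_of_genEntropy_le {m : ℕ} (hm : 1 ≤ m) {n₁ n₂ : ℕ}
    {S : Set (Fin m → ℕ)} {g : ℝ} (h₁ : ∀ ν ∈ S, n₁ ≤ ∑ i, ν i) (h₂ : ∀ ν ∈ S, ∑ i, ν i ≤ n₂)
    (hS : ∀ ν ∈ S, genEntropy (fun i => (ν i : ℝ)) ≤ g) :
    (numRealizations S : ℝ) ≤ Real.exp g * ∑ n ∈ Finset.Icc n₁ n₂, levelBound m n := by
  classical
  set U : Finset (Fin m → ℕ) := (Finset.Icc n₁ n₂).biUnion fun n =>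
    Finset.piAntidiag (Finset.univ : Finset (Fin m)) n
  have hSU : S = ((U.filter fun ν => ν ∈ S : Finset (Fin m → ℕ)) : Set (Fin m → ℕ)) := by
    ext ν
    simp only [U, Finset.coe_filter, Finset.mem_biUnion, Finset.mem_Icc, Set.mem_ofPred_eq]
    constructor
    · intro h
      exact ⟨⟨_, ⟨h₁ ν h, h₂ ν h⟩, by simp⟩, h⟩
    · exact fun h => h.2
  rw [hSU, numRealizations_eq_sum, Nat.cast_sum]
  have hdisj : (↑(Finset.Icc n₁ n₂) : Set ℕ).PairwiseDisjoint fun n =>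
      Finset.piAntidiag (Finset.univ : Finset (Fin m)) n := by
    intro n _ n' _ hne
    refine Finset.disjoint_left.2 fun ν h h' => hne ?_
    rw [← (Finset.mem_piAntidiag.1 h).1, ← (Finset.mem_piAntidiag.1 h').1]
  calc ∑ ν ∈ U.filter (fun ν => ν ∈ S), (numRealizations {ν} : ℝ)
      ≤ ∑ ν ∈ U.filter (fun ν => ν ∈ S),
          Real.exp g * ((numRealizations {ν} : ℝ) * Real.exp (-genEntropy fun i => (ν i : ℝ))) := by
        refine Finset.sum_le_sum fun ν hν => ?_
        have h := hS ν (Finset.mem_filter.1 hν).2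
        rw [mul_left_comm, ← Real.exp_add]
        exact le_mul_of_one_le_right (by positivity) (Real.one_le_exp (by linarith))
    _ ≤ ∑ ν ∈ U,
          Real.exp g * ((numRealizations {ν} : ℝ) * Real.exp (-genEntropy fun i => (ν i : ℝ))) :=
        Finset.sum_le_sum_of_subset_of_nonneg (Finset.filter_subset _ _) fun _ _ _ => by positivity
    _ ≤ _ := by
        rw [← Finset.mul_sum, Finset.sum_biUnion hdisj]
        gcongr with n _
        exact sum_level_le hm

/-! ### Superadditivity of the generalized entropy -/

/-- Gibbs' inequality for unnormalized vectors. -/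
theorem genEntropy_le_sum_neg_log {m : ℕ} {a p : Fin m → ℝ} (ha : ∀ i, 0 ≤ a i)
    (hp : ∀ i, 0 < p i) (hp1 : ∑ i, p i = 1) : genEntropy a ≤ ∑ i, a i * -Real.log (p i) := by
  set A := ∑ i, a i with hA
  have hterm (i : Fin m) :
      a i * Real.log A - a i * Real.log (a i) + a i * Real.log (p i) ≤ A * p i - a i := by
    rcases (ha i).eq_or_lt with h | h
    · rw [← h]
      have : 0 ≤ A := Finset.sum_nonneg fun i _ => ha i
      have := mul_nonneg this (hp i).le
      simpa using this
    · have hA0 : 0 < A := h.trans_le (Finset.single_le_sum (fun j _ => ha j) (Finset.mem_univ i))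
      have hpi := hp i
      have hl := Real.log_le_sub_one_of_pos (show 0 < A * p i / a i by positivity)
      rw [Real.log_div (by positivity) h.ne', Real.log_mul hA0.ne' hpi.ne'] at hl
      have := mul_le_mul_of_nonneg_left hl h.le
      have e : a i * (A * p i / a i - 1) = A * p i - a i := by field_simp
      rw [e] at this
      linarith
  have hsum := Finset.sum_le_sum fun i (_ : i ∈ Finset.univ) => hterm i
  rw [Finset.sum_add_distrib, Finset.sum_sub_distrib, Finset.sum_sub_distrib, ← Finset.sum_mul,
    ← Finset.mul_sum, hp1, mul_one, ← hA, sub_self] at hsum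
  simp only [genEntropy, mul_neg, Finset.sum_neg_distrib, ← hA]
  linarith

theorem genEntropy_eq_sum_neg_log {m : ℕ} {y : Fin m → ℝ} (hy : ∀ i, 0 < y i) :
    genEntropy y = ∑ i, y i * -Real.log (y i / ∑ j, y j) := by
  have h (i : Fin m) : y i * -Real.log (y i / ∑ j, y j) =
      y i * Real.log (∑ j, y j) - y i * Real.log (y i) := by
    have hs : 0 < ∑ j, y j :=
      (hy i).trans_le (Finset.single_le_sum (fun j _ => (hy j).le) (Finset.mem_univ i))
    rw [Real.log_div (hy i).ne' hs.ne']
    ring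
  rw [Finset.sum_congr rfl fun i _ => h i, Finset.sum_sub_distrib, ← Finset.sum_mul, genEntropy]
  ring

/-- The generalized entropy is superadditive and monotone. -/
theorem genEntropy_add_le {m : ℕ} (hm : 1 ≤ m) {a b y : Fin m → ℝ} (ha : ∀ i, 0 ≤ a i)
    (hb : ∀ i, 0 ≤ b i) (hy : ∀ i, 0 < y i) (hab : ∀ i, a i + b i ≤ y i) :
    genEntropy a + genEntropy b ≤ genEntropy y := by
  have hs : 0 < ∑ j, y j :=
    (hy ⟨0, hm⟩).trans_le (Finset.single_le_sum (fun j _ => (hy j).le) (Finset.mem_univ _))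
  have hp (i : Fin m) : 0 < y i / ∑ j, y j := div_pos (hy i) hs
  have hp1 : ∑ i, y i / ∑ j, y j = 1 := by rw [← Finset.sum_div, div_self hs.ne']
  have h1 := genEntropy_le_sum_neg_log ha hp hp1
  have h2 := genEntropy_le_sum_neg_log hb hp hp1
  rw [genEntropy_eq_sum_neg_log hy]
  refine (add_le_add h1 h2).trans ?_
  rw [← Finset.sum_add_distrib]
  refine Finset.sum_le_sum fun i _ => ?_
  rw [← add_mul]
  refine mul_le_mul_of_nonneg_right (hab i) (neg_nonneg.2 (Real.log_nonpos (hp i).le ?_))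
  exact (div_le_one hs).2 (Finset.single_le_sum (fun j _ => (hy j).le) (Finset.mem_univ i))

theorem two_mul_card_sub_one_le_genEntropy {m : ℕ} (T : Finset (Fin m)) (hT : T.Nonempty) :
    2 * ((T.card : ℝ) - 1) ≤ genEntropy fun i => if i ∈ T then 2 else 0 := by
  have hc : (0 : ℝ) < T.card := by exact_mod_cast hT.card_pos
  have h1 : ∑ i, (if i ∈ T then (2 : ℝ) else 0) = T.card * 2 := by
    rw [Finset.sum_ite_mem, Finset.univ_inter, Finset.sum_const, nsmul_eq_mul]
  have h2 : ∑ i, (if i ∈ T then (2 : ℝ) else 0) * Real.log (if i ∈ T then (2 : ℝ) else 0) =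
      T.card * (2 * Real.log 2) := by
    rw [← nsmul_eq_mul, ← Finset.sum_const, ← Finset.univ_inter T, ← Finset.sum_ite_mem]
    refine Finset.sum_congr rfl fun i _ => ?_
    by_cases hi : i ∈ T <;> simp [hi]
  rw [genEntropy, h1, h2, Real.log_mul hc.ne' (by norm_num)]
  have h := Real.one_sub_inv_le_log_of_pos hc
  have h' := mul_le_mul_of_nonneg_left h (show (0 : ℝ) ≤ 2 * T.card by positivity)
  have e : 2 * (T.card : ℝ) * (1 - (T.card : ℝ)⁻¹) = 2 * ((T.card : ℝ) - 1) := by field_simp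
  rw [e] at h'
  linarith

/-! ### Entropy loss under a unit shift -/

/-- The second derivative is `1 / y³ - 1 / (y (1 + y)²)`. -/
theorem convexOn_mul_log_add_inv :
    ConvexOn ℝ (Set.Ioi 0) fun y : ℝ =>
      y * (Real.log (1 + y) - Real.log y) + 1 / 2 * y⁻¹ := by
  have hint : interior (Set.Ioi (0 : ℝ)) = Set.Ioi 0 := isOpen_Ioi.interior_eq
  have hd1 (y : ℝ) (hy : 0 < y) : HasDerivAt (fun y : ℝ =>
      y * (Real.log (1 + y) - Real.log y) + 1 / 2 * y⁻¹)
      (Real.log (1 + y) - Real.log y + (1 + y)⁻¹ * y - 1 - 1 / 2 * (y ^ 2)⁻¹) y := by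
    have h1 : HasDerivAt (fun y : ℝ => Real.log (1 + y)) (1 / (1 + y)) y :=
      ((hasDerivAt_id y).const_add 1).log (by simp; positivity)
    have h := ((hasDerivAt_id y).mul (h1.sub (Real.hasDerivAt_log hy.ne'))).add
      ((hasDerivAt_inv hy.ne').const_mul (1 / 2))
    refine HasDerivAt.congr_deriv (f := _) h ?_
    simp only [Pi.sub_apply, id_eq]
    field_simp
    ring
  have hd2 (y : ℝ) (hy : 0 < y) : HasDerivAt (fun y : ℝ =>
      Real.log (1 + y) - Real.log y + (1 + y)⁻¹ * y - 1 - 1 / 2 * (y ^ 2)⁻¹)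
      ((y ^ 3)⁻¹ - (y * (1 + y) ^ 2)⁻¹) y := by
    have h0 : HasDerivAt (fun y : ℝ => 1 + y) 1 y := (hasDerivAt_id y).const_add 1
    have h1 : HasDerivAt (fun y : ℝ => Real.log (1 + y)) (1 / (1 + y)) y :=
      h0.log (by positivity)
    have h := (((h1.sub (Real.hasDerivAt_log hy.ne')).add
      ((h0.inv (by positivity)).mul (hasDerivAt_id y))).sub_const 1).sub
      (((hasDerivAt_pow 2 y).inv (by positivity)).const_mul (1 / 2))
    refine HasDerivAt.congr_deriv (f := _) h ?_
    simp only [Pi.inv_apply, id_eq]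
    push_cast
    field_simp
    ring
  refine convexOn_of_hasDerivWithinAt2_nonneg (convex_Ioi 0)
    (fun y hy => (hd1 y hy).continuousAt.continuousWithinAt)
    (fun y hy => (hd1 y (by rwa [hint] at hy)).hasDerivWithinAt)
    (fun y hy => (hd2 y (by rwa [hint] at hy)).hasDerivWithinAt) fun y hy => ?_
  have hy0 : 0 < y := by rwa [hint] at hy
  rw [sub_nonneg]
  refine inv_anti₀ (by positivity) ?_
  nlinarith [pow_pos hy0 2]

/-- The second-order bound for the loss of entropy when all entries are lowered by `1`. It reduces
to Jensen's inequality for the convex function of `convexOn_mul_log_add_inv`, at the points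
`xᵢ - 1`. -/
theorem genEntropy_le_genEntropy_sub_one {m : ℕ} (hm : 1 ≤ m) {x : Fin m → ℝ}
    (hx : ∀ i, 1 < x i) :
    genEntropy x + ∑ i, Real.log (x i / ∑ j, x j) -
      1 / 2 * ((∑ i, 1 / (x i - 1)) - (m : ℝ) / ((∑ j, x j) / m - 1)) ≤
      genEntropy fun i => x i - 1 := by
  have hm0 : (0 : ℝ) < m := by exact_mod_cast hm
  set s := ∑ j, x j with hs
  have hY : ∑ i, (x i - 1) = s - m := by simp [hs]
  have hY0 : 0 < s - m := by
    rw [← hY]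
    exact Finset.sum_pos (fun i _ => sub_pos.2 (hx i)) ⟨⟨0, hm⟩, Finset.mem_univ _⟩
  have hs0 : 0 < s := by linarith
  have hJ := convexOn_mul_log_add_inv.map_sum_le (t := Finset.univ) (w := fun _ : Fin m => (m : ℝ)⁻¹)
    (p := fun i => x i - 1) (fun _ _ => by positivity) (by simp [hm0.ne'])
    fun i _ => sub_pos.2 (hx i)
  simp only [smul_eq_mul] at hJ
  rw [← Finset.mul_sum, ← Finset.mul_sum, hY, ← div_eq_inv_mul, ← div_eq_inv_mul,
    le_div_iff₀ hm0] at hJ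
  have e1 : Real.log (1 + (s - m) / m) - Real.log ((s - m) / m) = Real.log s - Real.log (s - m) := by
    rw [show 1 + (s - m) / m = s / m by field_simp; ring, Real.log_div hs0.ne' hm0.ne',
      Real.log_div hY0.ne' hm0.ne']
    ring
  have e2 : ((s - m) / m)⁻¹ * m = (m : ℝ) / (s / m - 1) := by
    rw [show s / m - 1 = (s - m) / m by field_simp]
    field_simp
  have e3 : (s - m) / m * (Real.log s - Real.log (s - m)) * m =
      (s - m) * (Real.log s - Real.log (s - m)) := by field_simp
  rw [e1, add_mul, e3, mul_assoc, e2, Finset.sum_add_distrib, ← Finset.mul_sum] at hJ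
  have e4 : ∑ i, (x i - 1) * (Real.log (1 + (x i - 1)) - Real.log (x i - 1)) =
      ∑ i, x i * Real.log (x i) - ∑ i, Real.log (x i) - ∑ i, (x i - 1) * Real.log (x i - 1) := by
    rw [← Finset.sum_sub_distrib, ← Finset.sum_sub_distrib]
    refine Finset.sum_congr rfl fun i _ => ?_
    rw [add_sub_cancel]
    ring
  have e5 : ∑ i, Real.log (x i / s) = ∑ i, Real.log (x i) - m * Real.log s := by
    rw [Finset.sum_congr rfl fun i _ => Real.log_div (by linarith [hx i]) hs0.ne',
      Finset.sum_sub_distrib]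
    simp
  rw [e4] at hJ
  simp only [genEntropy, hY, ← hs, e5, one_div] at hJ ⊢
  linarith

/-! ### Optimal count vectors -/

theorem IsOptimalCountVector.sum_eq {m : ℕ} {x : Fin m → ℝ} {ν : Fin m → ℕ}
    (h : IsOptimalCountVector x ν) : ∑ i, ν i = ⌈∑ j, x j⌉₊ := by
  obtain ⟨ρ, T, -, hT, h0, hneg, hpos⟩ := h
  have hz : (∑ i, (ν i : ℤ)) = (⌈∑ j, x j⌉₊ : ℤ) := by
    have hTs : ∑ i, (if i ∈ T then (1 : ℤ) else 0) = T.card := by simp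
    rcases lt_trichotomy (∑ i, ρ i - (⌈∑ j, x j⌉₊ : ℤ)) 0 with hd | hd | hd
    · have e (i : Fin m) : (ν i : ℤ) = ρ i + if i ∈ T then 1 else 0 := by
        rw [(hneg hd).2 i]; split_ifs <;> simp
      rw [Finset.sum_congr rfl fun i _ => e i, Finset.sum_add_distrib, hTs, hT, abs_of_neg hd]
      ring
    · rw [Finset.sum_congr rfl fun i _ => h0 hd i]
      linarith
    · have e (i : Fin m) : (ν i : ℤ) = ρ i - if i ∈ T then 1 else 0 := by
        rw [(hpos hd).2 i]; split_ifs <;> simp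
      rw [Finset.sum_congr rfl fun i _ => e i, Finset.sum_sub_distrib, hTs, hT, abs_of_pos hd]
      ring
  exact_mod_cast hz

theorem IsOptimalCountVector.abs_sub_lt {m : ℕ} {x : Fin m → ℝ} {ν : Fin m → ℕ}
    (h : IsOptimalCountVector x ν) (i : Fin m) :
    |(ν i : ℝ) - (⌈∑ j, x j⌉₊ : ℝ) * (x i / ∑ j, x j)| < 1 := by
  obtain ⟨ρ, T, hρ, hT, h0, hneg, hpos⟩ := h
  have hi := abs_le.1 (hρ i)
  rw [abs_lt]
  rcases lt_trichotomy (∑ i, ρ i - (⌈∑ j, x j⌉₊ : ℤ)) 0 with hd | hd | hd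
  · have e := (hneg hd).2 i
    split_ifs at e with hiT
    · have e' : (ν i : ℝ) = ρ i + 1 := by exact_mod_cast e
      have := (hneg hd).1 i hiT
      constructor <;> linarith
    · have e' : (ν i : ℝ) = ρ i := by exact_mod_cast e
      constructor <;> linarith
  · have e' : (ν i : ℝ) = ρ i := by exact_mod_cast h0 hd i
    constructor <;> linarith
  · have e := (hpos hd).2 i
    split_ifs at e with hiT
    · have e' : (ν i : ℝ) = ρ i - 1 := by exact_mod_cast e
      have := (hpos hd).1 i hiT
      constructor <;> linarith
    · have e' : (ν i : ℝ) = ρ i := by exact_mod_cast e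
      constructor <;> linarith

/-- Logarithmic form of the comparison of an integral vector with the vector `x` it is obtained
from. The entropy is compared through `x - 1`. Entries above `xᵢ + 1` can occur, as the sum is
rounded up from `s` to `n`. If there are `b ≥ 1` of them, they contribute a loss of at most
`(b/2) ln (n/s)`; against it stand the term `(1/2) ln (n/s)` and the entropy
`2b ln b ≥ 2(b - 1)` gained by superadditivity, since these entries exceed `xᵢ - 1` by more than `2`. -/
theorem genEntropy_sub_sum_log_le {m : ℕ} (hm : 1 ≤ m) {x y : Fin m → ℝ} {n : ℝ}
    (hx : ∀ i, 1 < x i) (hsn : ∑ j, x j ≤ n) (hns : n ≤ ∑ j, x j + 1)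
    (hlow : ∀ i, x i - 1 ≤ y i) (hy : ∀ i, 0 < y i) (hup : ∀ i, y i ≤ n * (x i / ∑ j, x j) + 1) :
    1 / 2 * Real.log (∑ j, x j) +
        ∑ i, (Real.log (x i / ∑ j, x j) - 1 / 2 * Real.log (x i + 1)) -
        1 / 2 * ((∑ i, 1 / (x i - 1)) - (m : ℝ) / ((∑ j, x j) / m - 1)) + genEntropy x ≤
      genEntropy y + 1 / 2 * Real.log n - ∑ i, 1 / 2 * Real.log (y i) := by
  classical
  set s := ∑ j, x j with hs
  have hs1 : 1 < s := (hx ⟨0, hm⟩).trans_le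
    (Finset.single_le_sum (fun j _ => by linarith [hx j]) (Finset.mem_univ _))
  have hs0 : 0 < s := by linarith
  have hn0 : 0 < n := by linarith
  set L := Real.log n - Real.log s with hL
  have hL0 : 0 ≤ L := sub_nonneg.2 (Real.log_le_log hs0 hsn)
  have hL1 : L ≤ 1 := by
    rw [hL, ← Real.log_div hn0.ne' hs0.ne']
    refine (Real.log_le_sub_one_of_pos (by positivity)).trans ?_
    rw [sub_le_iff_le_add, div_le_iff₀ hs0]
    linarith
  set T : Finset (Fin m) := Finset.univ.filter fun i => x i + 1 < y i with hT
  have hent : genEntropy (fun i => x i - 1) +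
      genEntropy (fun i => if i ∈ T then (2 : ℝ) else 0) ≤ genEntropy y := by
    refine genEntropy_add_le hm (fun i => by linarith [hx i]) (fun i => by split_ifs <;> norm_num)
      hy fun i => ?_
    split_ifs with hi
    · have := (Finset.mem_filter.1 hi).2
      linarith
    · linarith [hlow i]
  have hlog : ∑ i, 1 / 2 * Real.log (y i) ≤
      ∑ i, 1 / 2 * Real.log (x i + 1) + T.card * (1 / 2 * L) := by
    have e : (T.card : ℝ) * (1 / 2 * L) = ∑ i, if i ∈ T then 1 / 2 * L else 0 := by
      rw [Finset.sum_ite_mem, Finset.univ_inter, Finset.sum_const, nsmul_eq_mul]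
    rw [e, ← Finset.sum_add_distrib]
    refine Finset.sum_le_sum fun i _ => ?_
    have hxi : 0 < x i + 1 := by linarith [hx i]
    split_ifs with hi
    · have h1 : y i ≤ (x i + 1) * (n / s) := by
        refine (hup i).trans ?_
        have : 1 ≤ n / s := (one_le_div hs0).2 hsn
        have e : n * (x i / s) = x i * (n / s) := by ring
        rw [e, add_mul]
        linarith
      have h2 := Real.log_le_log (hy i) h1
      rw [Real.log_mul hxi.ne' (by positivity), Real.log_div hn0.ne' hs0.ne'] at h2
      linarith
    · have h1 : y i ≤ x i + 1 := by
        by_contra! h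
        exact hi (Finset.mem_filter.2 ⟨Finset.mem_univ _, h⟩)
      have := Real.log_le_log (hy i) h1
      linarith
  have hloss : (T.card : ℝ) * (1 / 2 * L) ≤
      1 / 2 * L + genEntropy (fun i => if i ∈ T then (2 : ℝ) else 0) := by
    rcases T.eq_empty_or_nonempty with h0 | hne
    · rw [h0]
      simp [genEntropy]
      linarith
    · have h1 := two_mul_card_sub_one_le_genEntropy T hne
      have h2 : (1 : ℝ) ≤ T.card := by exact_mod_cast hne.card_pos
      nlinarith
  have hshift := genEntropy_le_genEntropy_sub_one hm hx
  rw [← hs] at hshift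
  rw [Finset.sum_sub_distrib]
  linarith

theorem sqrt_eq_exp_half_log {y : ℝ} (hy : 0 < y) : Real.sqrt y = Real.exp (1 / 2 * Real.log y) := by
  rw [Real.sqrt_eq_rpow, Real.rpow_def_of_pos hy, mul_comm]

/-- For an optimal count vector, the main part of Stirling's estimate dominates
`C₂ C₄ exp (G x)`. -/
theorem C2_mul_C4_mul_exp_le {m : ℕ} (hm : 1 ≤ m) {x : Fin m → ℝ} {ν : Fin m → ℕ}
    (hx : ∀ i, 1 < x i) (hν : IsOptimalCountVector x ν) :
    (∀ i, 1 ≤ ν i) ∧ C2 x * C4 x * Real.exp (genEntropy x) ≤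
      Real.exp (genEntropy fun i => (ν i : ℝ)) *
        (Real.sqrt (∑ i, (ν i : ℝ)) * ∏ i, (1 / Real.sqrt (ν i))) := by
  have hs1 : 1 < ∑ j, x j := (hx ⟨0, hm⟩).trans_le
    (Finset.single_le_sum (fun j _ => by linarith [hx j]) (Finset.mem_univ _))
  have hs0 : 0 < ∑ j, x j := by linarith
  have hsn : ∑ j, x j ≤ (⌈∑ j, x j⌉₊ : ℝ) := Nat.le_ceil _
  have habs (i : Fin m) := abs_lt.1 (hν.abs_sub_lt i)
  have hlow (i : Fin m) : x i - 1 < ν i := by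
    have h1 : x i ≤ (⌈∑ j, x j⌉₊ : ℝ) * (x i / ∑ j, x j) := by
      rw [mul_div_assoc', le_div_iff₀ hs0, mul_comm]
      exact mul_le_mul_of_nonneg_right hsn (by linarith [hx i])
    linarith [(habs i).1]
  have hpos (i : Fin m) : (0 : ℝ) < ν i := by linarith [hlow i, hx i]
  refine ⟨fun i => by exact_mod_cast hpos i, ?_⟩
  have hsum : ∑ i, (ν i : ℝ) = (⌈∑ j, x j⌉₊ : ℝ) := by exact_mod_cast hν.sum_eq
  have hmain := genEntropy_sub_sum_log_le hm hx hsn (Nat.ceil_lt_add_one hs0.le).le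
    (fun i => (hlow i).le) hpos fun i => by linarith [(habs i).2]
  have hn0 : (0 : ℝ) < (⌈∑ j, x j⌉₊ : ℝ) := by linarith
  have e1 (i : Fin m) : x i / (∑ j, x j) / Real.sqrt (x i + 1) =
      Real.exp (Real.log (x i / ∑ j, x j) - 1 / 2 * Real.log (x i + 1)) := by
    have := hx i
    rw [Real.exp_sub, Real.exp_log (div_pos (by linarith) hs0), sqrt_eq_exp_half_log (by linarith)]
  have e2 (i : Fin m) : 1 / Real.sqrt (ν i) = Real.exp (-(1 / 2 * Real.log (ν i))) := by
    rw [Real.exp_neg, sqrt_eq_exp_half_log (hpos i), one_div]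
  rw [C2, C4, hsum, sqrt_eq_exp_half_log hs0, sqrt_eq_exp_half_log hn0,
    Finset.prod_congr rfl fun i _ => e1 i, Finset.prod_congr rfl fun i _ => e2 i,
    ← Real.exp_sum, ← Real.exp_sum, ← Real.exp_add, ← Real.exp_add, ← Real.exp_add,
    ← Real.exp_add, ← Real.exp_add, Real.exp_le_exp, Finset.sum_neg_distrib]
  linarith

theorem C2_pos {m : ℕ} (hm : 1 ≤ m) {x : Fin m → ℝ} (hx : ∀ i, 1 < x i) : 0 < C2 x := by
  have hs0 : 0 < ∑ j, x j :=
    Finset.sum_pos (fun i _ => by linarith [hx i]) ⟨⟨0, hm⟩, Finset.mem_univ _⟩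
  refine mul_pos (Real.sqrt_pos.2 hs0) (Finset.prod_pos fun i _ => ?_)
  have := hx i
  exact div_pos (div_pos (by linarith) hs0) (Real.sqrt_pos.2 (by linarith))

theorem sub_lt_C3 {m : ℕ} {s₁ s₂ : ℝ} (hs₂ : 0 ≤ s₂) :
    (Real.sqrt m + Real.sqrt (⌈s₂⌉₊ + 1 : ℕ)) ^ (m + 1) -
      (Real.sqrt m + Real.sqrt (⌈s₁⌉₊ : ℝ)) ^ (m + 1) < C3 m s₁ s₂ := by
  have h1 : Real.sqrt s₁ ≤ Real.sqrt (⌈s₁⌉₊ : ℝ) := Real.sqrt_le_sqrt (Nat.le_ceil _)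
  have h2 : Real.sqrt (⌈s₂⌉₊ + 1 : ℕ) < Real.sqrt (s₂ + 2) := by
    refine Real.sqrt_lt_sqrt (by positivity) ?_
    have := Nat.ceil_lt_add_one hs₂
    push_cast
    linarith
  have h3 : (Real.sqrt m + Real.sqrt (⌈s₂⌉₊ + 1 : ℕ)) ^ (m + 1) <
      (Real.sqrt m + Real.sqrt (s₂ + 2)) ^ (m + 1) := by
    gcongr
  have h4 : (Real.sqrt m + Real.sqrt s₁) ^ (m + 1) ≤
      (Real.sqrt m + Real.sqrt (⌈s₁⌉₊ : ℝ)) ^ (m + 1) := by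
    gcongr
  rw [C3]
  linarith

theorem ConstraintData.sums_nonneg {m p q : ℕ} {D : ConstraintData m p q} {s : ℝ}
    (hs : s ∈ D.sums) : 0 ≤ s := by
  obtain ⟨y, hy, rfl⟩ := hs
  exact Finset.sum_nonneg fun i _ => hy.2.2 i

end MaxGEnt

theorem mainTheorem1 {m p q : ℕ} (hm : 1 ≤ m)
    (D : MaxGEnt.ConstraintData m p q)
    (βE : Fin p → ℝ) (βI : Fin q → ℝ)
    (hβE : MaxGEnt.IsToleranceVector D.bE βE) (hβI : MaxGEnt.IsToleranceVector D.bI βI)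
    (x : Fin m → ℝ) (s₁ s₂ : ℝ)
    (hx : D.IsMaxGEnt x) (hs₁ : IsLeast D.sums s₁) (hs₂ : IsGreatest D.sums s₂)
    (hx1 : ∀ i, 1 < x i)
    (ν : Fin m → ℕ) (hν : MaxGEnt.IsOptimalCountVector x ν)
    (δ η : ℝ) (hδ : 0 < δ) (hη : 0 < η) :
    ((m + 1 : ℝ) * Real.exp (-(m : ℝ) / 12) * Real.Gamma ((m : ℝ) / 2) /
          (2 * Real.pi ^ ((m : ℝ) / 2)) *
        (MaxGEnt.C2 x * MaxGEnt.C4 x / MaxGEnt.C3 m s₁ s₂) *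
        Real.exp (η * MaxGEnt.genEntropy x)) *
      (MaxGEnt.numRealizations
        (D.lowEntropySet βE βI ⌈s₁⌉₊ ⌈s₂⌉₊ (MaxGEnt.genEntropy x) δ η) : ℝ) <
    (MaxGEnt.numRealizations {ν} : ℝ) := by
  open MaxGEnt in
  have hm0 : (0 : ℝ) < m := by exact_mod_cast hm
  have hpi := Real.pi_pos
  have hΓ : 0 < Real.Gamma ((m : ℝ) / 2) := Real.Gamma_pos_of_pos (by positivity)
  have hs₁₂ : s₁ ≤ s₂ := hs₁.2 hs₂.1
  have hC3 := sub_lt_C3 (m := m) (s₁ := s₁) (ConstraintData.sums_nonneg hs₂.1)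
  have hB := (numRealizations_le_of_genEntropy_le hm
    (S := D.lowEntropySet βE βI ⌈s₁⌉₊ ⌈s₂⌉₊ (genEntropy x) δ η) (fun μ hμ => hμ.1)
    (fun μ hμ => hμ.2.1) (fun μ hμ => hμ.2.2.2.le)).trans
    (mul_le_mul_of_nonneg_left (sum_levelBound_le hm (Nat.ceil_mono hs₁₂)) (Real.exp_pos _).le)
  obtain ⟨hν1, hopt⟩ := C2_mul_C4_mul_exp_le hm hx1 hν
  have hlow := le_numRealizations_singleton hm ν hν1
  have hC2 := C2_pos hm hx1
  have hC4 : 0 < C4 x := Real.exp_pos _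
  have hC30 : 0 < C3 m s₁ s₂ := by
    refine lt_of_le_of_lt (sub_nonneg.2 ?_) hC3
    have : Real.sqrt (⌈s₁⌉₊ : ℝ) ≤ Real.sqrt (⌈s₂⌉₊ + 1 : ℕ) := by
      refine Real.sqrt_le_sqrt ?_
      exact_mod_cast (Nat.ceil_mono hs₁₂).trans (Nat.le_succ _)
    gcongr
  set N : ℝ := (numRealizations
    (D.lowEntropySet βE βI ⌈s₁⌉₊ ⌈s₂⌉₊ (genEntropy x) δ η) : ℝ)
  set d : ℝ := (Real.sqrt m + Real.sqrt (⌈s₂⌉₊ + 1 : ℕ)) ^ (m + 1) -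
      (Real.sqrt m + Real.sqrt (⌈s₁⌉₊ : ℝ)) ^ (m + 1)
  have hpm : Real.pi ^ ((m : ℝ) / 2) = Real.sqrt Real.pi ^ m := by
    rw [Real.sqrt_eq_rpow, ← Real.rpow_mul_natCast hpi.le]
    ring_nf
  have hexp : Real.exp (η * genEntropy x) * Real.exp ((1 - η) * genEntropy x) =
      Real.exp (genEntropy x) := by
    rw [← Real.exp_add]; ring_nf
  calc _ ≤ ((m + 1 : ℝ) * Real.exp (-(m : ℝ) / 12) * Real.Gamma ((m : ℝ) / 2) /
          (2 * Real.pi ^ ((m : ℝ) / 2)) * (C2 x * C4 x / C3 m s₁ s₂) *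
          Real.exp (η * genEntropy x)) *
        (Real.exp ((1 - η) * genEntropy x) *
          (Real.sqrt (2 * Real.pi) / (Real.sqrt 2 ^ m * Real.Gamma ((m : ℝ) / 2)) *
            (2 / (m + 1)) * d)) := by gcongr
    _ = Real.exp (-(m : ℝ) / 12) * Real.sqrt (2 * Real.pi) * (1 / Real.sqrt (2 * Real.pi)) ^ m *
        (C2 x * C4 x * Real.exp (genEntropy x)) * (d / C3 m s₁ s₂) := by
        rw [← hexp, hpm, one_div_pow, Real.sqrt_mul (by norm_num), mul_pow]
        field_simp
    _ < Real.exp (-(m : ℝ) / 12) * Real.sqrt (2 * Real.pi) * (1 / Real.sqrt (2 * Real.pi)) ^ m *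
        (C2 x * C4 x * Real.exp (genEntropy x)) :=
        mul_lt_of_lt_one_right (by positivity) ((div_lt_one hC30).2 hC3)
    _ ≤ _ := (mul_le_mul_of_nonneg_left hopt (by positivity)).trans hlow
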